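/- Let $D$ be a finite directed multigraph (parallel edges allowed) on $2n$ vertices that has no directed cycle, has a unique source $s$ (vertex of indegree $0$) and a unique sink $t$ (vertex of outdegree $0$), is $3$-regular (indegree plus outdegree equals $3$ at every vertex), and is $2$-edge-connected (the underlying undirected multigraph is connected and remains connected after the deletion of any single edge). Then $D$ has at most $2^n+1$ directed paths from $s$ to $t$, where paths are regarded as sequences of edges, so that paths using different parallel edges are different. Moreover, the bound is tight for every $n \ge 1$: for each $n\ge 1$ there is such a $D$ on $2n$ vertices with exactly $2^n+1$ directed paths from $s$ to $t$. -/

import Mathlib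

/-- A directed multigraph with vertex set `V` and edge set `E`; parallel edges (and, a priori,
loops) are allowed. -/
structure MultiDigraph (V E : Type*) where
  /-- initial vertex of an edge -/
  src : E → V
  /-- final vertex of an edge -/
  tgt : E → V

namespace MultiDigraph

/-- `D.IsDiwalk u p v`: the list of edges `p` is a directed walk from `u` to `v`. -/
def IsDiwalk {V E : Type*} (D : MultiDigraph V E) : V → List E → V → Prop
  | u, [], v => u = v
  | u, e :: p, v => D.src e = u ∧ D.IsDiwalk (D.tgt e) p v

/-- `D.IsDipath u p v`: the list of edges `p` is a directed path from `u` to `v`, that is, a directed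
walk which visits no vertex twice. Parallel edges give rise to different paths. -/
def IsDipath {V E : Type*} (D : MultiDigraph V E) (u : V) (p : List E) (v : V) : Prop :=
  D.IsDiwalk u p v ∧ (u :: p.map D.tgt).Nodup

/-- There is no closed directed walk of positive length. -/
def IsAcyclic {V E : Type*} (D : MultiDigraph V E) : Prop :=
  ∀ (v : V) (p : List E), D.IsDiwalk v p v → p = []

/-- The number of edges ending at `v`. -/
def indeg {V E : Type*} [Fintype E] [DecidableEq V] (D : MultiDigraph V E) (v : V) : ℕ :=
  (Finset.univ.filter fun e => D.tgt e = v).card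

/-- The number of edges starting at `v`. -/
def outdeg {V E : Type*} [Fintype E] [DecidableEq V] (D : MultiDigraph V E) (v : V) : ℕ :=
  (Finset.univ.filter fun e => D.src e = v).card

/-- Every vertex has degree `d` in the underlying undirected multigraph. -/
def IsRegular {V E : Type*} [Fintype E] [DecidableEq V] (D : MultiDigraph V E) (d : ℕ) : Prop :=
  ∀ v, D.indeg v + D.outdeg v = d

/-- `s` is the one and only source (vertex of indegree `0`). -/
def IsUniqueSource {V E : Type*} [Fintype E] [DecidableEq V] (D : MultiDigraph V E) (s : V) :
    Prop :=
  ∀ v, D.indeg v = 0 ↔ v = s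

/-- `t` is the one and only sink (vertex of outdegree `0`). -/
def IsUniqueSink {V E : Type*} [Fintype E] [DecidableEq V] (D : MultiDigraph V E) (t : V) :
    Prop :=
  ∀ v, D.outdeg v = 0 ↔ v = t

/-- After deletion of the edges in `F`, the vertices `u` and `v` are still joined by a path in the
underlying undirected multigraph. -/
def ReachableWithout {V E : Type*} (D : MultiDigraph V E) (F : Finset E) (u v : V) : Prop :=
  Relation.EqvGen (fun a b => ∃ e, e ∉ F ∧ D.src e = a ∧ D.tgt e = b) u v

/-- `k`-edge-connectedness of the underlying undirected multigraph: the deletion of fewer than `k`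
edges never disconnects it. -/
def IsEdgeConnected {V E : Type*} (D : MultiDigraph V E) (k : ℕ) : Prop :=
  ∀ F : Finset E, F.card < k → ∀ u v : V, D.ReachableWithout F u v

/-- The set of directed paths from `s` to `t`. -/
def dipaths {V E : Type*} (D : MultiDigraph V E) (s t : V) : Set (List E) :=
  {p | D.IsDipath s p t}

end MultiDigraph

/-! Let `Q v` count the walks from `v` to `t`; by acyclicity walks are paths (`encard_dipaths_eq`).
For a successor-closed set `A` containing `t` but not `s`, let S(A) be the sum of `Q` over the heads
of the edges entering `A`. Remove from `A` a vertex `v ≠ t` that comes first in the acyclic order.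
By `sum_edgesInto_add`, S(A) = S(A \ v) + (indeg v - 1) Q(v). So indegree 1 changes nothing, while
indegree 2 adds Q(v). In that case the one edge leaving `v` enters A \ v, and 2-edge-connectedness
gives a second entering edge, so Q(v) ≤ S(A \ v) - 1. Thus x ↦ 2x - 1 bounds the growth, and it
sends 2^k + 1 to 2^(k+1) + 1. The start is S({t}) ≤ 3, the end is S(V \ s) = Q(s), and degree
counting gives n - 1 vertices of indegree 2.

Equality holds for a path with alternate edges doubled plus a chord from `s` to `t`: n binary
choices, or the chord. -/

namespace MultiDigraph

/-! ### Counting walks in acyclic digraphs -/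

section Walks

variable {V E : Type*} {D : MultiDigraph V E}

/-- In a finite acyclic digraph, the number of vertices reachable from a vertex strictly decreases
along every edge. -/
theorem IsAcyclic.exists_corank [Fintype V] (h : D.IsAcyclic) :
    ∃ r : V → ℕ, ∀ e, r (D.tgt e) < r (D.src e) := by
  classical
  refine ⟨fun v => (Finset.univ.filter fun u => ∃ p, D.IsDiwalk v p u).card, fun e => ?_⟩
  refine Finset.card_lt_card (Finset.ssubset_iff_of_subset ?_ |>.2 ⟨D.src e, ?_, ?_⟩)
  · intro u hu
    obtain ⟨p, hp⟩ := (Finset.mem_filter.1 hu).2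
    exact Finset.mem_filter.2 ⟨Finset.mem_univ _, e :: p, rfl, hp⟩
  · exact Finset.mem_filter.2 ⟨Finset.mem_univ _, [], rfl⟩
  · intro hu
    obtain ⟨p, hp⟩ := (Finset.mem_filter.1 hu).2
    exact List.cons_ne_nil e p (h (D.src e) (e :: p) ⟨rfl, hp⟩)

variable {r : V → ℕ}

theorem IsDiwalk.corank_lt (hr : ∀ e, r (D.tgt e) < r (D.src e)) {u v : V} {p : List E}
    (hp : D.IsDiwalk u p v) : ∀ x ∈ p.map D.tgt, r x < r u := by
  induction p generalizing u with
  | nil => simp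
  | cons e p ih =>
    obtain ⟨rfl, hp⟩ := hp
    intro x hx
    rw [List.map_cons, List.mem_cons] at hx
    rcases hx with rfl | hx
    · exact hr e
    · exact (ih hp x hx).trans (hr e)

theorem IsDiwalk.isDipath (hr : ∀ e, r (D.tgt e) < r (D.src e)) {u v : V} {p : List E}
    (hp : D.IsDiwalk u p v) : D.IsDipath u p v := by
  refine ⟨hp, ?_⟩
  induction p generalizing u with
  | nil => simp
  | cons e p ih =>
    exact List.nodup_cons.2 ⟨fun hx => (hp.corank_lt hr u hx).false, ih hp.2⟩

theorem isAcyclic_of_corank (hr : ∀ e, r (D.tgt e) < r (D.src e)) : D.IsAcyclic := by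
  intro v p hp
  cases p with
  | nil => rfl
  | cons e p =>
    exfalso
    obtain ⟨rfl, hp⟩ := hp
    have key : ∀ (p : List E) (u w : V), D.IsDiwalk u p w → r w ≤ r u := by
      intro p
      induction p with
      | nil => rintro u w rfl; exact le_rfl
      | cons f p ih =>
        rintro u w ⟨rfl, hw⟩
        exact (ih _ _ hw).trans (hr f).le
    exact absurd (hr e) (key _ _ _ hp).not_gt

/-- If `Q` satisfies the recursion for the number of directed walks ending at `t`, then it counts
the directed paths ending at `t`. -/
theorem encard_dipaths_eq [Fintype E] [DecidableEq V] (hr : ∀ e, r (D.tgt e) < r (D.src e))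
    {t : V} {Q : V → ℕ} (ht : ∀ e, D.src e ≠ t) (hQt : Q t = 1)
    (hQ : ∀ v, v ≠ t → Q v = ∑ e with D.src e = v, Q (D.tgt e)) (v : V) :
    (D.dipaths v t).encard = Q v := by
  classical
  -- Realizing the walks as a finset settles finiteness and cardinality in one induction on the
  -- corank.
  suffices h : ∀ k v, r v < k → ∃ W : Finset (List E),
      (∀ p, p ∈ W ↔ D.IsDiwalk v p t) ∧ W.card = Q v by
    obtain ⟨W, hW, hc⟩ := h _ v (Nat.lt_succ_self _)
    rw [← hc, ← Set.encard_coe_eq_coe_finsetCard]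
    congr 1
    ext p
    exact ⟨fun hp => (hW p).2 hp.1, fun hp => ((hW p).1 hp).isDipath hr⟩
  intro k
  induction k with
  | zero => intro v hv; exact absurd hv (Nat.not_lt_zero _)
  | succ k ih =>
    intro v hv
    by_cases hvt : v = t
    · subst hvt
      refine ⟨{[]}, fun p => ?_, by simp [hQt]⟩
      cases p with
      | nil => simp [IsDiwalk]
      | cons e p => simpa [IsDiwalk] using fun h => absurd h (ht e)
    · have ih' : ∀ e, ∃ W : Finset (List E), D.src e = v →
          (∀ p, p ∈ W ↔ D.IsDiwalk (D.tgt e) p t) ∧ W.card = Q (D.tgt e) := by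
        intro e
        by_cases he : D.src e = v
        · obtain ⟨W, hW⟩ := ih (D.tgt e) (by have := hr e; rw [he] at this; omega)
          exact ⟨W, fun _ => hW⟩
        · exact ⟨∅, fun h => absurd h he⟩
      choose W hW using ih'
      refine ⟨(Finset.univ.filter fun e => D.src e = v).biUnion
        fun e => (W e).image (List.cons e), fun p => ?_, ?_⟩
      · simp only [Finset.mem_biUnion, Finset.mem_filter, Finset.mem_univ, true_and,
          Finset.mem_image]
        constructor
        · rintro ⟨e, he, q, hq, rfl⟩
          exact ⟨he, ((hW e he).1 q).1 hq⟩
        · intro hp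
          cases p with
          | nil => exact absurd hp hvt
          | cons e p => exact ⟨e, hp.1, p, ((hW e hp.1).1 p).2 hp.2, rfl⟩
      · rw [Finset.card_biUnion, hQ v hvt]
        · refine Finset.sum_congr rfl fun e he => ?_
          rw [Finset.card_image_of_injective _ (List.cons_injective),
            (hW e (Finset.mem_filter.1 he).2).2]
        · intro e _ f _ hef
          refine Finset.disjoint_left.2 fun p hp hq => ?_
          obtain ⟨_, _, rfl⟩ := Finset.mem_image.1 hp
          obtain ⟨_, _, h⟩ := Finset.mem_image.1 hq
          exact hef (List.cons.inj h).1.symm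

/-- Well-founded recursion along the corank, done with fuel `k`: values at vertices of corank below
`k` no longer depend on `k`, so fuel `r v + 1` suffices at `v`. -/
theorem exists_walk_count [Fintype E] [DecidableEq V] (hr : ∀ e, r (D.tgt e) < r (D.src e))
    (t : V) : ∃ Q : V → ℕ, Q t = 1 ∧
      ∀ v, v ≠ t → Q v = ∑ e with D.src e = v, Q (D.tgt e) := by
  suffices h : ∀ k, ∃ Q : V → ℕ, Q t = 1 ∧
      ∀ v, r v < k → v ≠ t → Q v = ∑ e with D.src e = v, Q (D.tgt e) by
    classical
    choose Q hQt hQ using h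
    have hstable : ∀ m k l v, r v < m → r v < k → r v < l → Q k v = Q l v := by
      intro m
      induction m with
      | zero => intro k l v h; exact absurd h (Nat.not_lt_zero _)
      | succ m ih =>
        intro k l v h hk hl
        by_cases hv : v = t
        · rw [hv, hQt, hQt]
        · rw [hQ k v hk hv, hQ l v hl hv]
          refine Finset.sum_congr rfl fun e he => ?_
          have h1 := hr e
          rw [(Finset.mem_filter.1 he).2] at h1
          exact ih k l _ (by omega) (by omega) (by omega)
    refine ⟨fun v => Q (r v + 1) v, hQt _, fun v hv => ?_⟩
    dsimp only
    rw [hQ _ v (Nat.lt_succ_self _) hv]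
    refine Finset.sum_congr rfl fun e he => ?_
    have h1 := hr e
    rw [(Finset.mem_filter.1 he).2] at h1
    exact hstable _ _ _ _ (Nat.lt_succ_self _) (by omega) (by omega)
  intro k
  induction k with
  | zero => exact ⟨fun _ => 1, rfl, fun v h => absurd h (Nat.not_lt_zero _)⟩
  | succ k ih =>
    obtain ⟨Q, hQt, hQ⟩ := ih
    refine ⟨fun v => if v = t then 1 else ∑ e with D.src e = v, Q (D.tgt e), by simp, ?_⟩
    intro v hv hvt
    simp only [hvt, if_false]
    refine Finset.sum_congr rfl fun e he => ?_
    have h1 := hr e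
    rw [(Finset.mem_filter.1 he).2] at h1
    split_ifs with h
    · rw [h, hQt]
    · exact hQ _ (by omega) h

end Walks

/-! ### The upper bound, by shrinking successor-closed sets -/

section UpperBound

variable {V E : Type*} [Fintype E] [DecidableEq V] {D : MultiDigraph V E}

theorem src_ne_of_outdeg_eq_zero {t : V} (ht : D.outdeg t = 0) (e : E) : D.src e ≠ t := fun h => by
  have := Finset.card_eq_zero.1 ht
  exact Finset.notMem_empty e (this ▸ Finset.mem_filter.2 ⟨Finset.mem_univ _, h⟩)

theorem exists_src_eq_of_outdeg_ne_zero {v : V} (hv : D.outdeg v ≠ 0) : ∃ e, D.src e = v := by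
  obtain ⟨e, he⟩ := Finset.card_ne_zero.1 hv
  exact ⟨e, (Finset.mem_filter.1 he).2⟩

/-- The edges entering the vertex set `A`. -/
def edgesInto (D : MultiDigraph V E) (A : Finset V) : Finset E :=
  Finset.univ.filter fun e => D.src e ∉ A ∧ D.tgt e ∈ A

theorem mem_edgesInto {A : Finset V} {e : E} :
    e ∈ D.edgesInto A ↔ D.src e ∉ A ∧ D.tgt e ∈ A := by
  simp [edgesInto]

/-- No edge leaves `A`, so the entering edges form the whole undirected cut, and deleting them
separates `s` from `t`. -/
theorem two_le_card_edgesInto (hD : D.IsEdgeConnected 2) {A : Finset V}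
    (hA : ∀ e, D.src e ∈ A → D.tgt e ∈ A) {s t : V} (hs : s ∉ A) (ht : t ∈ A) :
    2 ≤ (D.edgesInto A).card := by
  by_contra h
  have key : ∀ a b, D.ReachableWithout (D.edgesInto A) a b → (a ∈ A ↔ b ∈ A) := by
    intro a b hab
    induction hab with
    | rel a b h =>
      obtain ⟨e, he, rfl, rfl⟩ := h
      refine ⟨hA e, fun hb => ?_⟩
      by_contra ha
      exact he (mem_edgesInto.2 ⟨ha, hb⟩)
    | refl => exact Iff.rfl
    | symm _ _ _ ih => exact ih.symm
    | trans _ _ _ _ _ ih₁ ih₂ => exact ih₁.trans ih₂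
  exact hs ((key s t (hD _ (by omega) s t)).2 ht)

/-- Edges into `v` start outside `A`, as `A.erase v` is closed, so they count only for `A`; edges
out of `v` count only for `A.erase v`. All others count equally for both. -/
theorem sum_edgesInto_add {A : Finset V} {v : V} (hv : v ∈ A)
    (hA : ∀ e, D.src e ∈ A → D.tgt e ∈ A)
    (hA' : ∀ e, D.src e ∈ A.erase v → D.tgt e ∈ A.erase v) (hloop : ∀ e, D.src e ≠ D.tgt e)
    (Q : V → ℕ) :
    ∑ e ∈ D.edgesInto A, Q (D.tgt e) + ∑ e with D.src e = v, Q (D.tgt e) =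
      ∑ e ∈ D.edgesInto (A.erase v), Q (D.tgt e) + D.indeg v * Q v := by
  have h : D.indeg v * Q v = ∑ e with D.tgt e = v, Q (D.tgt e) := by
    rw [Finset.sum_congr rfl (g := fun _ => Q v)
      fun e he => by rw [(Finset.mem_filter.1 he).2], Finset.sum_const, smul_eq_mul, indeg]
  rw [h]
  simp only [edgesInto, Finset.sum_filter]
  rw [← Finset.sum_add_distrib, ← Finset.sum_add_distrib]
  refine Finset.sum_congr rfl fun e _ => ?_
  have h1 := hA e
  have h2 := hA' e
  have h3 := hloop e
  simp only [Finset.mem_erase] at h2 ⊢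
  by_cases hs : D.src e = v
  · have ht : D.tgt e ≠ v := fun ht => h3 (hs.trans ht.symm)
    have := h1 (hs ▸ hv)
    simp [hs, ht, hv, this]
  · by_cases ht : D.tgt e = v
    · have : D.src e ∉ A := fun h => (h2 ⟨hs, h⟩).1 ht
      simp [hs, ht, hv, this]
    · simp [hs, ht]

theorem walk_count_pos {r : V → ℕ} (hr : ∀ e, r (D.tgt e) < r (D.src e)) {t : V}
    (ht : D.IsUniqueSink t) {Q : V → ℕ} (hQt : Q t = 1)
    (hQ : ∀ v, v ≠ t → Q v = ∑ e with D.src e = v, Q (D.tgt e)) (v : V) : 0 < Q v := by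
  induction hk : r v using Nat.strong_induction_on generalizing v with
  | _ k ih =>
    by_cases hv : v = t
    · rw [hv, hQt]; exact one_pos
    · obtain ⟨e, he⟩ := exists_src_eq_of_outdeg_ne_zero (fun h => hv ((ht v).1 h))
      have h1 := hr e
      rw [he, hk] at h1
      rw [hQ v hv]
      exact (ih _ h1 _ rfl).trans_le (Finset.single_le_sum (f := fun e => Q (D.tgt e))
        (fun _ _ => Nat.zero_le _) (Finset.mem_filter.2 ⟨Finset.mem_univ e, he⟩))

theorem sum_edgesInto_le {r : V → ℕ} (hr : ∀ e, r (D.tgt e) < r (D.src e))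
    (hreg : D.IsRegular 3) (hcon : D.IsEdgeConnected 2) {s t : V} (hs : D.IsUniqueSource s)
    (ht : D.IsUniqueSink t) {Q : V → ℕ} (hQt : Q t = 1)
    (hQ : ∀ v, v ≠ t → Q v = ∑ e with D.src e = v, Q (D.tgt e)) (A : Finset V)
    (hA : ∀ e, D.src e ∈ A → D.tgt e ∈ A) (hsA : s ∉ A) (htA : t ∈ A) :
    ∑ e ∈ D.edgesInto A, Q (D.tgt e) ≤ 2 ^ ((A.filter fun v => D.indeg v = 2).card + 1) + 1 := by
  classical
  have ht0 := (ht t).2 rfl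
  induction hk : A.card generalizing A with
  | zero => exact absurd (Finset.card_eq_zero.1 hk ▸ htA) (Finset.notMem_empty t)
  | succ k ih =>
    rcases (A.erase t).eq_empty_or_nonempty with hE | hE
    · have hAt : A = {t} := by
        rw [← Finset.insert_erase htA, hE, insert_empty_eq]
      have h3 := hreg t
      calc ∑ e ∈ D.edgesInto A, Q (D.tgt e) ≤ ∑ e with D.tgt e = t, Q (D.tgt e) := by
            refine Finset.sum_le_sum_of_subset fun e he => ?_
            have := (mem_edgesInto.1 he).2
            rw [hAt, Finset.mem_singleton] at this
            exact Finset.mem_filter.2 ⟨Finset.mem_univ _, this⟩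
        _ = D.indeg t := by
            rw [Finset.sum_congr rfl (g := fun _ => 1)
              fun e he => by rw [(Finset.mem_filter.1 he).2, hQt]]
            simp [indeg]
        -- The sink has indegree 3, which is the source of the constant.
        _ ≤ 2 ^ (0 + 1) + 1 := by omega
        _ ≤ _ := by gcongr <;> omega
    -- Maximal corank means that no edge from within `A` ends at `v`, so `A.erase v` stays closed.
    · obtain ⟨v, hv, hmax⟩ := Finset.exists_max_image _ r hE
      obtain ⟨hvt, hvA⟩ := Finset.mem_erase.1 hv
      have hvs : v ≠ s := fun h => hsA (h ▸ hvA)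
      have hA' : ∀ e, D.src e ∈ A.erase v → D.tgt e ∈ A.erase v := by
        intro e he
        have he' := (Finset.mem_erase.1 he).2
        refine Finset.mem_erase.2 ⟨fun h => ?_, hA e he'⟩
        have h1 := hmax _ (Finset.mem_erase.2 ⟨src_ne_of_outdeg_eq_zero ht0 e, he'⟩)
        have h2 := hr e
        rw [h] at h2
        omega
      have hsA' : s ∉ A.erase v := fun h => hsA (Finset.mem_of_mem_erase h)
      have htA' : t ∈ A.erase v := Finset.mem_erase.2 ⟨hvt.symm, htA⟩
      have hcard : (A.erase v).card = k := by rw [Finset.card_erase_of_mem hvA, hk]; rfl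
      have IH := ih _ hA' hsA' htA' hcard
      have hsum := sum_edgesInto_add hvA hA hA' (fun e h => (h ▸ hr e).false) Q
      rw [← hQ v hvt, Finset.filter_erase] at *
      have hin : D.indeg v ≠ 0 := fun h => hvs ((hs v).1 h)
      have hout : D.outdeg v ≠ 0 := fun h => hvt ((ht v).1 h)
      have h3 := hreg v
      by_cases h2 : D.indeg v = 2
      · have hvf : v ∈ A.filter fun v => D.indeg v = 2 := Finset.mem_filter.2 ⟨hvA, h2⟩
        rw [Finset.card_erase_add_one hvf] at IH
        have hout1 : D.outdeg v = 1 := by omega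
        obtain ⟨e, he⟩ := Finset.card_eq_one.1 hout1
        have hev : D.src e = v := by
          have := he.symm ▸ Finset.mem_singleton_self e
          simpa using this
        have hQv : Q v = Q (D.tgt e) := by rw [hQ v hvt, he, Finset.sum_singleton]
        have heI : e ∈ D.edgesInto (A.erase v) := by
          refine mem_edgesInto.2 ⟨by simp [hev], Finset.mem_erase.2 ⟨fun h => ?_, ?_⟩⟩
          · exact (h ▸ hev ▸ hr e).false
          · exact hA e (hev ▸ hvA)
        obtain ⟨f, hf, hfe⟩ := Finset.exists_mem_ne
          (two_le_card_edgesInto hcon hA' hsA' htA') e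
        -- The edge `e` alone contributes `Q v`, and the second entering edge `f` at least 1.
        have hle : Q v + 1 ≤ ∑ e ∈ D.edgesInto (A.erase v), Q (D.tgt e) := by
          rw [hQv, ← Finset.add_sum_erase _ _ heI]
          refine Nat.add_le_add_left ?_ _
          exact (walk_count_pos hr ht hQt hQ (D.tgt f)).trans_le
            (Finset.single_le_sum (f := fun e => Q (D.tgt e)) (fun _ _ => Nat.zero_le _)
              (Finset.mem_erase.2 ⟨hfe, hf⟩))
        rw [h2] at hsum
        rw [pow_succ]
        omega
      · have h1 : D.indeg v = 1 := by omega
        have hvf : v ∉ A.filter fun v => D.indeg v = 2 := fun h => h2 (Finset.mem_filter.1 h).2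
        rw [Finset.erase_eq_of_notMem hvf] at IH
        rw [h1] at hsum
        omega

theorem sum_indeg_eq_sum_outdeg [Fintype V] :
    ∑ v, D.indeg v = ∑ v, D.outdeg v := by
  unfold indeg outdeg
  rw [← Finset.card_eq_sum_card_fiberwise fun _ _ => Finset.mem_univ _,
    ← Finset.card_eq_sum_card_fiberwise fun _ _ => Finset.mem_univ _]

theorem card_indeg_two_add_one [Fintype V] {n : ℕ} (hV : Fintype.card V = 2 * n)
    (hreg : D.IsRegular 3) {s t : V} (hs : D.IsUniqueSource s) (ht : D.IsUniqueSink t) :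
    (Finset.univ.filter fun v => D.indeg v = 2).card + 1 = n := by
  have hs0 := (hs s).2 rfl
  have ht0 := (ht t).2 rfl
  have hst : s ≠ t := by
    rintro rfl
    have := hreg s
    omega
  have h1 : ∑ v, D.indeg v = 3 * n := by
    have h2 : ∑ v, (D.indeg v + D.outdeg v) = 2 * n * 3 := by
      rw [Finset.sum_congr rfl fun v _ => hreg v, Finset.sum_const, Finset.card_univ, hV,
        smul_eq_mul]
    rw [Finset.sum_add_distrib, ← sum_indeg_eq_sum_outdeg] at h2
    omega
  -- Indegrees are 0 at `s`, 3 at `t` and 1 or 2 elsewhere; the indicators correct for this, and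
  -- summing gives 3n + 1 = 2n + #{indegree 2} + 2.
  have h2 : ∑ v, (D.indeg v + if v = s then 1 else 0) =
      ∑ v, (1 + (if D.indeg v = 2 then 1 else 0) + if v = t then 2 else 0) := by
    refine Finset.sum_congr rfl fun v _ => ?_
    have h3 := hreg v
    have h4 := hs v
    have h5 := ht v
    by_cases hvs : v = s
    · subst hvs
      simp [hs0, hst]
    · by_cases hvt : v = t
      · subst hvt
        have : D.indeg v = 3 := by omega
        simp [this, hvs]
      · have : D.indeg v = 1 ∨ D.indeg v = 2 := by
          simp only [hvs, hvt, iff_false] at h4 h5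
          omega
        rcases this with h | h <;> simp [h, hvs, hvt]
  simp only [Finset.sum_add_distrib, h1, Finset.sum_ite_eq', Finset.mem_univ, if_true,
    Finset.sum_const, Finset.card_univ, hV, smul_eq_mul] at h2
  rw [← Finset.card_filter] at h2
  omega

theorem encard_dipaths_le [Fintype V] {n : ℕ} (hV : Fintype.card V = 2 * n) (hac : D.IsAcyclic)
    (hreg : D.IsRegular 3) (hcon : D.IsEdgeConnected 2) {s t : V} (hs : D.IsUniqueSource s)
    (ht : D.IsUniqueSink t) : (D.dipaths s t).encard ≤ 2 ^ n + 1 := by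
  obtain ⟨r, hr⟩ := hac.exists_corank
  obtain ⟨Q, hQt, hQ⟩ := exists_walk_count hr t
  have hs0 := (hs s).2 rfl
  have ht0 := (ht t).2 rfl
  have hst : s ≠ t := by
    rintro rfl
    have := hreg s
    omega
  have htgt : ∀ e, D.tgt e ≠ s := fun e h => by
    have := Finset.card_eq_zero.1 hs0
    exact Finset.notMem_empty e (this ▸ Finset.mem_filter.2 ⟨Finset.mem_univ _, h⟩)
  rw [encard_dipaths_eq hr (src_ne_of_outdeg_eq_zero ht0) hQt hQ s]
  have h := sum_edgesInto_le hr hreg hcon hs ht hQt hQ (Finset.univ.erase s)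
    (fun e _ => Finset.mem_erase.2 ⟨htgt e, Finset.mem_univ _⟩) (by simp)
    (Finset.mem_erase.2 ⟨hst.symm, Finset.mem_univ _⟩)
  have hI : D.edgesInto (Finset.univ.erase s) = Finset.univ.filter fun e => D.src e = s := by
    ext e
    simp [mem_edgesInto, htgt e]
  have hsf : s ∉ Finset.univ.filter fun v => D.indeg v = 2 := by simp [hs0]
  rw [Finset.filter_erase, Finset.erase_eq_of_notMem hsf,
    card_indeg_two_add_one hV hreg hs ht, hI, ← hQ s hst] at h
  exact_mod_cast h

end UpperBound

/-! ### The extremal example -/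

section Tightness

variable {n : ℕ}

/-- The directed path `0, 1, …, 2n - 1` with every other edge, beginning with the first, doubled,
together with an edge from its first vertex to its last. -/
def doubledPath (n : ℕ) : MultiDigraph (Fin (2 * n)) (Fin (3 * n)) where
  -- Edges 3i and 3i + 1 both join 2i to 2i + 1, edge 3i + 2 joins 2i + 1 to 2i + 2, and the last
  -- edge 3n - 1 is the chord.
  src e := ⟨if e.1 % 3 = 2 then if e.1 + 1 = 3 * n then 0 else 2 * (e.1 / 3) + 1
    else 2 * (e.1 / 3), by have := e.2; split_ifs <;> omega⟩
  tgt e := ⟨if e.1 % 3 = 2 then if e.1 + 1 = 3 * n then 2 * n - 1 else 2 * (e.1 / 3) + 2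
    else 2 * (e.1 / 3) + 1, by have := e.2; split_ifs <;> omega⟩

theorem doubledPath_src_eq {e : Fin (3 * n)} {v : Fin (2 * n)} :
    (doubledPath n).src e = v ↔ (if e.1 % 3 = 2 then if e.1 + 1 = 3 * n then 0
      else 2 * (e.1 / 3) + 1 else 2 * (e.1 / 3)) = v.1 :=
  Fin.ext_iff

theorem doubledPath_tgt_eq {e : Fin (3 * n)} {v : Fin (2 * n)} :
    (doubledPath n).tgt e = v ↔ (if e.1 % 3 = 2 then if e.1 + 1 = 3 * n then 2 * n - 1
      else 2 * (e.1 / 3) + 2 else 2 * (e.1 / 3) + 1) = v.1 :=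
  Fin.ext_iff

theorem doubledPath_src_lt_tgt (e : Fin (3 * n)) :
    (doubledPath n).src e < (doubledPath n).tgt e := by
  have := e.2
  rw [Fin.lt_def]
  simp only [doubledPath]
  split_ifs <;> omega

theorem doubledPath_corank (e : Fin (3 * n)) :
    2 * n - ((doubledPath n).tgt e).1 < 2 * n - ((doubledPath n).src e).1 := by
  have h := Fin.lt_def.1 (doubledPath_src_lt_tgt e)
  have := ((doubledPath n).tgt e).2
  omega

theorem doubledPath_out_zero (hn : 1 ≤ n) :
    (Finset.univ.filter fun e => (doubledPath n).src e = ⟨0, by omega⟩) =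
      {⟨0, by omega⟩, ⟨1, by omega⟩, ⟨3 * n - 1, by omega⟩} := by
  ext e
  have := e.2
  simp only [Finset.mem_filter, Finset.mem_univ, true_and, doubledPath_src_eq,
    Finset.mem_insert, Finset.mem_singleton]
  simp only [Fin.ext_iff]
  split_ifs <;> first | omega | (rw [false_iff]; omega)

theorem doubledPath_out_even {i : ℕ} (hi : i < n) (h0 : i ≠ 0) :
    (Finset.univ.filter fun e => (doubledPath n).src e = ⟨2 * i, by omega⟩) =
      {⟨3 * i, by omega⟩, ⟨3 * i + 1, by omega⟩} := by
  ext e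
  have := e.2
  simp only [Finset.mem_filter, Finset.mem_univ, true_and, doubledPath_src_eq,
    Finset.mem_insert, Finset.mem_singleton]
  simp only [Fin.ext_iff]
  split_ifs <;> omega

theorem doubledPath_out_odd {i : ℕ} (hi : i + 1 < n) :
    (Finset.univ.filter fun e => (doubledPath n).src e = ⟨2 * i + 1, by omega⟩) =
      {⟨3 * i + 2, by omega⟩} := by
  ext e
  have := e.2
  simp only [Finset.mem_filter, Finset.mem_univ, true_and, doubledPath_src_eq,
    Finset.mem_singleton]
  simp only [Fin.ext_iff]
  split_ifs <;> first | omega | (rw [false_iff]; omega)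

theorem doubledPath_out_last (hn : 1 ≤ n) :
    (Finset.univ.filter fun e => (doubledPath n).src e = ⟨2 * n - 1, by omega⟩) = ∅ := by
  ext e
  have := e.2
  simp only [Finset.mem_filter, Finset.mem_univ, true_and, doubledPath_src_eq,
    Finset.notMem_empty, iff_false]
  split_ifs <;> omega

theorem doubledPath_in_zero (hn : 1 ≤ n) :
    (Finset.univ.filter fun e => (doubledPath n).tgt e = ⟨0, by omega⟩) = ∅ := by
  ext e
  have := e.2
  simp only [Finset.mem_filter, Finset.mem_univ, true_and, doubledPath_tgt_eq,
    Finset.notMem_empty, iff_false]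
  split_ifs <;> first | omega | exact not_false

theorem doubledPath_in_even {i : ℕ} (hi : i < n) (h0 : i ≠ 0) :
    (Finset.univ.filter fun e => (doubledPath n).tgt e = ⟨2 * i, by omega⟩) =
      {⟨3 * i - 1, by omega⟩} := by
  ext e
  have := e.2
  simp only [Finset.mem_filter, Finset.mem_univ, true_and, doubledPath_tgt_eq,
    Finset.mem_singleton]
  simp only [Fin.ext_iff]
  split_ifs <;> omega

theorem doubledPath_in_odd {i : ℕ} (hi : i + 1 < n) :
    (Finset.univ.filter fun e => (doubledPath n).tgt e = ⟨2 * i + 1, by omega⟩) =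
      {⟨3 * i, by omega⟩, ⟨3 * i + 1, by omega⟩} := by
  ext e
  have := e.2
  simp only [Finset.mem_filter, Finset.mem_univ, true_and, doubledPath_tgt_eq,
    Finset.mem_insert, Finset.mem_singleton]
  simp only [Fin.ext_iff]
  split_ifs <;> omega

theorem doubledPath_in_last (hn : 1 ≤ n) :
    (Finset.univ.filter fun e => (doubledPath n).tgt e = ⟨2 * n - 1, by omega⟩) =
      {⟨3 * n - 3, by omega⟩, ⟨3 * n - 2, by omega⟩, ⟨3 * n - 1, by omega⟩} := by
  ext e
  have := e.2
  simp only [Finset.mem_filter, Finset.mem_univ, true_and, doubledPath_tgt_eq,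
    Finset.mem_insert, Finset.mem_singleton]
  simp only [Fin.ext_iff]
  split_ifs <;> omega

/-- A case distinction on the four kinds of vertices of `doubledPath n`. -/
theorem fin_two_mul_cases {motive : Fin (2 * n) → Prop} (hn : 1 ≤ n)
    (zero : motive ⟨0, by omega⟩) (last : motive ⟨2 * n - 1, by omega⟩)
    (even : ∀ i (hi : i < n), i ≠ 0 → motive ⟨2 * i, by omega⟩)
    (odd : ∀ i (hi : i + 1 < n), motive ⟨2 * i + 1, by omega⟩) (v : Fin (2 * n)) : motive v := by
  obtain ⟨k, hk⟩ := v
  by_cases h0 : k = 0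
  · subst h0; exact zero
  by_cases h1 : k = 2 * n - 1
  · subst h1; exact last
  rcases Nat.even_or_odd' k with ⟨i, rfl | rfl⟩
  · exact even i (by omega) (by omega)
  · exact odd i (by omega)

theorem doubledPath_indeg_outdeg (hn : 1 ≤ n) (v : Fin (2 * n)) :
    (doubledPath n).indeg v + (doubledPath n).outdeg v = 3 ∧
    ((doubledPath n).indeg v = 0 ↔ v = ⟨0, by omega⟩) ∧
    ((doubledPath n).outdeg v = 0 ↔ v = ⟨2 * n - 1, by omega⟩) := by
  unfold indeg outdeg
  induction v using fin_two_mul_cases hn with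
  | zero =>
    rw [doubledPath_in_zero hn, doubledPath_out_zero hn, Finset.card_eq_three.2
      ⟨_, _, _, ?_, ?_, ?_, rfl⟩]
    · simp [Fin.ext_iff]; omega
    all_goals simp [Fin.ext_iff]; try omega
  | last =>
    rw [doubledPath_in_last hn, doubledPath_out_last hn, Finset.card_eq_three.2
      ⟨_, _, _, ?_, ?_, ?_, rfl⟩]
    · simp [Fin.ext_iff]; omega
    all_goals simp [Fin.ext_iff]; try omega
  | even i hi h0 =>
    rw [doubledPath_in_even hi h0, doubledPath_out_even hi h0, Finset.card_pair (by simp)]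
    simp [Fin.ext_iff]; omega
  | odd i hi =>
    rw [doubledPath_in_odd hi, doubledPath_out_odd hi, Finset.card_pair (by simp)]
    simp [Fin.ext_iff]; omega

theorem encard_dipaths_doubledPath (hn : 1 ≤ n) :
    ((doubledPath n).dipaths ⟨0, by omega⟩ ⟨2 * n - 1, by omega⟩).encard = 2 ^ n + 1 := by
  rw [encard_dipaths_eq (r := fun v => 2 * n - v.1)
    -- The exponent is the number of doubled edges still ahead of `v`; the extra 1 at the source is
    -- the chord.
    (Q := fun v => 2 ^ (n - (v.1 + 1) / 2) + if v.1 = 0 then 1 else 0)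
    doubledPath_corank]
  · simp
  · exact src_ne_of_outdeg_eq_zero ((doubledPath_indeg_outdeg hn _).2.2.2 rfl)
  · have h : n - (2 * n - 1 + 1) / 2 = 0 := by omega
    have h' : 2 * n - 1 ≠ 0 := by omega
    simp only [h, h', if_false, pow_zero]
  · intro v hv
    induction v using fin_two_mul_cases hn with
    | zero =>
      rw [doubledPath_out_zero hn, Finset.sum_insert, Finset.sum_pair]
      · have h1 : (3 * n - 1) % 3 = 2 := by omega
        have h2 : 3 * n - 1 + 1 = 3 * n := by omega
        have h3 : n - (2 * n - 1 + 1) / 2 = 0 := by omega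
        have h4 : 2 * n - 1 ≠ 0 := by omega
        obtain ⟨m, rfl⟩ := Nat.exists_eq_add_of_le' hn
        simp only [doubledPath, h1, h2, h3, h4, if_true, if_false, Nat.reduceMod, Nat.reduceDiv,
          Nat.reduceMul, Nat.reduceAdd, OfNat.zero_ne_ofNat,
          OfNat.one_ne_ofNat, one_ne_zero, Nat.add_sub_cancel, Nat.sub_zero, pow_zero]
        ring
      all_goals simp [Fin.ext_iff]; try omega
    | last => exact absurd rfl hv
    | even i hi h0 =>
      rw [doubledPath_out_even hi h0, Finset.sum_pair (by simp)]
      obtain ⟨m, rfl⟩ := Nat.exists_eq_add_of_lt hi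
      have h1 : (3 * i) % 3 ≠ 2 := by omega
      have h2 : (3 * i + 1) % 3 ≠ 2 := by omega
      have h3 : (3 * i + 1) / 3 = i := by omega
      have h4 : 3 * i / 3 = i := by omega
      have h5 : i + m + 1 - (2 * i + 1) / 2 = m + 1 := by omega
      have h6 : i + m + 1 - (2 * i + 1 + 1) / 2 = m := by omega
      have h7 : 2 * i ≠ 0 := by omega
      have h8 : 2 * i + 1 ≠ 0 := by omega
      simp only [doubledPath, h1, h2, h3, h4, h5, h6, h7, h8, if_false]
      ring
    | odd i hi =>
      rw [doubledPath_out_odd hi, Finset.sum_singleton]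
      have h1 : (3 * i + 2) % 3 = 2 := by omega
      have h2 : 3 * i + 2 + 1 ≠ 3 * n := by omega
      have h3 : (3 * i + 2) / 3 = i := by omega
      have h4 : (2 * i + 1 + 1) / 2 = i + 1 := by omega
      have h5 : (2 * i + 2 + 1) / 2 = i + 1 := by omega
      have h7 : 2 * i + 1 ≠ 0 := by omega
      have h8 : 2 * i + 2 ≠ 0 := by omega
      simp only [doubledPath, h1, h2, h3, h4, h5, h7, h8, if_false, if_true]

theorem isEdgeConnected_doubledPath (hn : 1 ≤ n) : (doubledPath n).IsEdgeConnected 2 := by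
  intro F hF
  have hF1 : ∀ e ∈ F, ∀ f ∈ F, e = f := Finset.card_le_one.1 (by omega)
  have hedge : ∀ e ∉ F, (doubledPath n).ReachableWithout F
      ((doubledPath n).src e) ((doubledPath n).tgt e) :=
    fun e he => Relation.EqvGen.rel _ _ ⟨e, he, rfl, rfl⟩
  have hdouble : ∀ i (hi : i < n), (doubledPath n).ReachableWithout F
      ⟨2 * i, by omega⟩ ⟨2 * i + 1, by omega⟩ := by
    intro i hi
    have : ∃ e ∉ F, (doubledPath n).src e = ⟨2 * i, by omega⟩ ∧
        (doubledPath n).tgt e = ⟨2 * i + 1, by omega⟩ := by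
      -- At most one edge is deleted, so one of the two parallel edges survives.
      by_cases h : (⟨3 * i, by omega⟩ : Fin (3 * n)) ∈ F
      · refine ⟨⟨3 * i + 1, by omega⟩, fun h' => ?_, ?_, ?_⟩
        · simpa using hF1 _ h _ h'
        · rw [doubledPath_src_eq]; dsimp only; split_ifs <;> omega
        · rw [doubledPath_tgt_eq]; dsimp only; split_ifs <;> omega
      · refine ⟨⟨3 * i, by omega⟩, h, ?_, ?_⟩
        · rw [doubledPath_src_eq]; dsimp only; split_ifs <;> omega
        · rw [doubledPath_tgt_eq]; dsimp only; split_ifs <;> omega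
    obtain ⟨e, he, h1, h2⟩ := this
    exact h1 ▸ h2 ▸ hedge e he
  have hsingle : ∀ i (hi : i + 1 < n), (⟨3 * i + 2, by omega⟩ : Fin (3 * n)) ∉ F →
      (doubledPath n).ReachableWithout F ⟨2 * i + 1, by omega⟩ ⟨2 * i + 2, by omega⟩ := by
    intro i hi he
    have h1 : (doubledPath n).src ⟨3 * i + 2, by omega⟩ = ⟨2 * i + 1, by omega⟩ := by
      rw [doubledPath_src_eq]; dsimp only; split_ifs <;> omega
    have h2 : (doubledPath n).tgt ⟨3 * i + 2, by omega⟩ = ⟨2 * i + 2, by omega⟩ := by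
      rw [doubledPath_tgt_eq]; dsimp only; split_ifs <;> omega
    exact h1 ▸ h2 ▸ hedge _ he
  have hchord : (⟨3 * n - 1, by omega⟩ : Fin (3 * n)) ∉ F →
      (doubledPath n).ReachableWithout F ⟨0, by omega⟩ ⟨2 * n - 1, by omega⟩ := by
    intro he
    have h1 : (doubledPath n).src ⟨3 * n - 1, by omega⟩ = ⟨0, by omega⟩ := by
      rw [doubledPath_src_eq]; dsimp only; split_ifs <;> omega
    have h2 : (doubledPath n).tgt ⟨3 * n - 1, by omega⟩ = ⟨2 * n - 1, by omega⟩ := by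
      rw [doubledPath_tgt_eq]; dsimp only; split_ifs <;> omega
    exact h1 ▸ h2 ▸ hedge _ he
  -- consecutive pairs of vertices are joined wherever the connecting edge survives
  have hup : ∀ a b (hab : a ≤ b), ∀ hb : b < n,
      (∀ i, a ≤ i → i < b → ∀ hi : 3 * i + 2 < 3 * n, (⟨3 * i + 2, hi⟩ : Fin (3 * n)) ∉ F) →
      (doubledPath n).ReachableWithout F ⟨2 * a, by omega⟩ ⟨2 * b, by omega⟩ := by
    intro a b hab
    induction b, hab using Nat.le_induction with
    | base => intro _ _; exact Relation.EqvGen.refl _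
    | succ b hab ih =>
      intro hb h
      exact ((ih (by omega) fun i h1 h2 => h i h1 (by omega)).trans _ _ _
        (hdouble b (by omega))).trans _ _ _ (hsingle b hb (h b hab (by omega) (by omega)))
  have heven : ∀ i (hi : i < n), (doubledPath n).ReachableWithout F
      ⟨0, by omega⟩ ⟨2 * i, by omega⟩ := by
    intro i hi
    -- If the deleted edge lies on the path before 2i, go around: take the chord to the last vertex
    -- and follow the path backwards.
    by_cases h : ∃ j, ∃ hj : j < i, (⟨3 * j + 2, by omega⟩ : Fin (3 * n)) ∈ F
    · obtain ⟨j, hj, hjF⟩ := h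
      have h1 := hchord fun h' => by
        have := Fin.ext_iff.1 (hF1 _ hjF _ h')
        dsimp only at this
        omega
      have h2 := hup i (n - 1) (by omega) (by omega) fun k hk _ _ h' => by
        have := Fin.ext_iff.1 (hF1 _ hjF _ h')
        dsimp only at this
        omega
      have h3 := hdouble (n - 1) (by omega)
      have h4 : (⟨2 * (n - 1) + 1, by omega⟩ : Fin (2 * n)) = ⟨2 * n - 1, by omega⟩ :=
        Fin.ext (by dsimp only; omega)
      rw [h4] at h3
      exact h1.trans _ _ _ (h2.trans _ _ _ h3).symm
    · exact hup 0 i (by omega) hi fun k _ hk _ h' => h ⟨k, hk, h'⟩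
  have hall : ∀ v, (doubledPath n).ReachableWithout F ⟨0, by omega⟩ v := by
    rintro ⟨k, hk⟩
    rcases Nat.even_or_odd' k with ⟨i, rfl | rfl⟩
    · exact heven i (by omega)
    · exact (heven i (by omega)).trans _ _ _ (hdouble i (by omega))
  exact fun u v => ((hall u).symm).trans _ _ _ (hall v)

end Tightness

end MultiDigraph

theorem mainTheorem5 :
    (∀ (n : ℕ) (V : Type*) (E : Type*) [Fintype V] [Fintype E] [DecidableEq V]
        (D : MultiDigraph V E) (s t : V),
      Fintype.card V = 2 * n → D.IsAcyclic → D.IsRegular 3 → D.IsEdgeConnected 2 →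
      D.IsUniqueSource s → D.IsUniqueSink t →
      (D.dipaths s t).encard ≤ 2 ^ n + 1) ∧
    (∀ n : ℕ, 1 ≤ n →
      ∃ (D : MultiDigraph (Fin (2 * n)) (Fin (3 * n))) (s t : Fin (2 * n)),
        D.IsAcyclic ∧ D.IsRegular 3 ∧ D.IsEdgeConnected 2 ∧
        D.IsUniqueSource s ∧ D.IsUniqueSink t ∧
        (D.dipaths s t).encard = 2 ^ n + 1) := by
  refine ⟨fun n V E _ _ _ D s t hV hac hreg hcon hs ht =>
    MultiDigraph.encard_dipaths_le hV hac hreg hcon hs ht, fun n hn => ?_⟩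
  have hdeg := MultiDigraph.doubledPath_indeg_outdeg hn
  exact ⟨MultiDigraph.doubledPath n, ⟨0, by omega⟩, ⟨2 * n - 1, by omega⟩,
    MultiDigraph.isAcyclic_of_corank (r := fun v => 2 * n - v.1) MultiDigraph.doubledPath_corank,
    fun v => (hdeg v).1, MultiDigraph.isEdgeConnected_doubledPath hn,
    fun v => (hdeg v).2.1, fun v => (hdeg v).2.2, MultiDigraph.encard_dipaths_doubledPath hn⟩
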